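/- Let $q\ge 3$ be a prime power, let $\mathbb F_q$ be the finite field with $q$ elements, and let $n\ge 2$ be an integer. Call a matrix $A\in M_n(\mathbb F_q)$ *cyclic* if there is a vector $v\in\mathbb F_q^n$ such that $v,Av,\ldots,A^{n-1}v$ generate $\mathbb F_q^n$, and call it *semisimple* if its minimal polynomial is a product of distinct monic irreducible separable polynomials in $\mathbb F_q[x]$. Then every matrix in $M_n(\mathbb F_q)$ is (a) a sum of two invertible cyclic matrices in $M_n(\mathbb F_q)$; and (b) a sum of two invertible semisimple matrices in $M_n(\mathbb F_q)$. -/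

import Mathlib

/-- A matrix `A` over a commutative ring `R` is cyclic if some vector `v` is such that
`v, A v, …, A ^ (m - 1) v` generate the `R`-module `R ^ m`. -/
def Matrix.IsCyclicMatrix {R : Type*} [CommRing R] {m : ℕ} (A : Matrix (Fin m) (Fin m) R) : Prop :=
  ∃ v : Fin m → R,
    Submodule.span R (Set.range fun i : Fin m => (A ^ (i : ℕ)).mulVec v) = ⊤

/-- A matrix over a field is semisimple if its minimal polynomial is a product of distinct monic
polynomials, each of them irreducible and separable. -/
def Matrix.IsSemisimpleMatrix {K : Type*} [Field K] {m : ℕ} (A : Matrix (Fin m) (Fin m) K) : Prop :=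
  ∃ s : Finset (Polynomial K),
    (∀ f ∈ s, f.Monic ∧ Irreducible f ∧ f.Separable) ∧ minpoly K A = ∏ f ∈ s, f

/-! Three elements suffice because every choice below avoids at most two values. Cyclic sums:
conjugate to Hessenberg form and split each subdiagonal entry into two nonzero summands, which makes
both Hessenberg summands cyclic. Adding `t` and `-t` in the top right corner keeps cyclicity, and
each determinant is affine in `t` with nonzero slope, so some `t` makes both invertible. Semisimple
sums: by the structure theorem, reduce to multiplication by the root `x` on `K[X]/(p^e)`. Altering
the image of the last power of `x` gives `h` with a prescribed monic polynomial `Q(X - l)`, and `d =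
x - h` has rank at most one with `d² = μd`. Then `x = (l + d) + (h - l)`, where the summands are
killed by `(X - l)(X - l - μ)` and `Q`; it remains to make these squarefree and nonzero at 0. -/

open Polynomial in
theorem Module.End.isUnit_of_aeval_eq_zero {K V : Type*} [Field K] [AddCommGroup V] [Module K V]
    {f : Module.End K V} {p : K[X]} (hp : aeval f p = 0) (h0 : p.eval 0 ≠ 0) : IsUnit f := by
  have h := congrArg (aeval f) (X_mul_divX_add p)
  rw [hp, map_add, map_mul, aeval_X, aeval_C, coeff_zero_eq_eval_zero] at h
  have hcomm : Commute f (aeval f p.divX) := by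
    simpa using (Commute.all (X : K[X]) p.divX).map (aeval f)
  have hunit : IsUnit (f * aeval f p.divX) := by
    rw [eq_neg_of_add_eq_zero_left h, IsUnit.neg_iff]
    exact (IsUnit.mk0 _ h0).map (algebraMap K (Module.End K V))
  exact (hcomm.isUnit_mul_iff.mp hunit).1

/-! ### Semisimple sums: conjugation and products -/

/-- An endomorphism which is a sum of two invertible semisimple endomorphisms. -/
def Module.End.IsSumOfInvertibleSemisimple {K V : Type*} [Field K] [AddCommGroup V] [Module K V]
    (f : Module.End K V) : Prop :=
  ∃ g h : Module.End K V, (IsUnit g ∧ g.IsSemisimple) ∧ (IsUnit h ∧ h.IsSemisimple) ∧ f = g + h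

theorem Module.End.IsSumOfInvertibleSemisimple.conj {K V W : Type*} [Field K]
    [AddCommGroup V] [Module K V] [AddCommGroup W] [Module K W] {f : Module.End K V}
    (hf : f.IsSumOfInvertibleSemisimple) (e : V ≃ₗ[K] W) {f' : Module.End K W}
    (hf' : ∀ v, f' (e v) = e (f v)) : f'.IsSumOfInvertibleSemisimple := by
  obtain ⟨g, h, ⟨hg, hg'⟩, ⟨hh, hh'⟩, rfl⟩ := hf
  refine ⟨e.conj g, e.conj h, ⟨hg.map (e.conjAlgEquiv K), ?_⟩, ⟨hh.map (e.conjAlgEquiv K), ?_⟩, ?_⟩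
  · exact (e.isSemisimple_iff g (e.conj g) (by ext; simp)).mp hg'
  · exact (e.isSemisimple_iff h (e.conj h) (by ext; simp)).mp hh'
  · ext w
    obtain ⟨v, rfl⟩ := e.surjective w
    simp [hf', LinearEquiv.conj_apply]

/-- The algebra of componentwise endomorphisms of a product. -/
def Module.End.piAlgHom (K : Type*) {ι : Type*} (V : ι → Type*) [Field K]
    [∀ i, AddCommGroup (V i)] [∀ i, Module K (V i)] :
    (∀ i, Module.End K (V i)) →ₐ[K] Module.End K (∀ i, V i) where
  toFun g := LinearMap.pi fun i => g i ∘ₗ LinearMap.proj i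
  map_one' := rfl
  map_mul' _ _ := rfl
  map_zero' := rfl
  map_add' _ _ := rfl
  commutes' _ := rfl

-- Each minimal polynomial is squarefree, so it divides the radical of their product; this one
-- squarefree polynomial kills every component.
open Polynomial UniqueFactorizationMonoid in
theorem Module.End.isSemisimple_piAlgHom {K ι : Type*} {V : ι → Type*} [Field K] [Fintype ι]
    [∀ i, AddCommGroup (V i)] [∀ i, Module K (V i)] [∀ i, FiniteDimensional K (V i)]
    {g : ∀ i, Module.End K (V i)} (hg : ∀ i, (g i).IsSemisimple) :
    (piAlgHom K V g).IsSemisimple := by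
  classical
  have hne : ∏ i, minpoly K (g i) ≠ 0 :=
    Finset.prod_ne_zero_iff.mpr fun i _ => minpoly.ne_zero (Algebra.IsIntegral.isIntegral _)
  refine isSemisimple_of_squarefree_aeval_eq_zero
    (p := radical (∏ i, minpoly K (g i))) squarefree_radical ?_
  rw [aeval_algHom_apply]
  convert map_zero (piAlgHom K V)
  ext1 i
  have h : aeval g (radical (∏ i, minpoly K (g i))) i =
      aeval (g i) (radical (∏ i, minpoly K (g i))) :=
    (aeval_algHom_apply (Pi.evalAlgHom K (fun i => Module.End K (V i)) i) g _).symm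
  rw [h]
  refine aeval_eq_zero_of_dvd_aeval_eq_zero ?_ (minpoly.aeval K (g i))
  rw [dvd_radical_iff (hg i).minpoly_squarefree.isRadical hne]
  exact Finset.dvd_prod_of_mem _ (Finset.mem_univ i)

theorem Module.End.IsSumOfInvertibleSemisimple.piAlgHom {K ι : Type*} {V : ι → Type*} [Field K]
    [Fintype ι] [∀ i, AddCommGroup (V i)] [∀ i, Module K (V i)]
    [∀ i, FiniteDimensional K (V i)] {f : ∀ i, Module.End K (V i)}
    (hf : ∀ i, (f i).IsSumOfInvertibleSemisimple) :
    (Module.End.piAlgHom K V f).IsSumOfInvertibleSemisimple := by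
  choose g h hg hh hgh using hf
  refine ⟨Module.End.piAlgHom K V g, Module.End.piAlgHom K V h,
    ⟨(Pi.isUnit_iff.mpr fun i => (hg i).1).map _, isSemisimple_piAlgHom fun i => (hg i).2⟩,
    ⟨(Pi.isUnit_iff.mpr fun i => (hh i).1).map _, isSemisimple_piAlgHom fun i => (hh i).2⟩, ?_⟩
  rw [← map_add]
  congr 1
  exact funext hgh

/-! ### Semisimple sums: the cyclic case -/

theorem exists_ne_ne_of_three_le_card {α : Type*} [Fintype α] (h : 3 ≤ Fintype.card α)
    (a b : α) : ∃ c, c ≠ a ∧ c ≠ b := by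
  classical
  obtain ⟨c, -, hc⟩ := Finset.exists_mem_notMem_of_card_lt_card (s := {a, b}) (t := Finset.univ)
    (by rw [Finset.card_univ]; exact (Finset.card_le_two).trans_lt (by omega))
  exact ⟨c, by simpa using hc⟩

-- The derivative is `X^k((k+2)X - (k+1)s)`. The root 0 is excluded by `c ≠ 0`, the other root by
-- `h1`; if `k + 2` vanishes in `K`, the linear factor is the nonzero constant `s`.
open Polynomial in
theorem Polynomial.squarefree_X_pow_sub_sub {K : Type*} [Field K] (k : ℕ) {s c : K} (hc : c ≠ 0)
    (h0 : ((k + 2 : ℕ) : K) = 0 → s ≠ 0)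
    (h1 : ∀ r : K, ((k + 2 : ℕ) : K) * r = (k + 1 : ℕ) * s → c ≠ r ^ (k + 2) - s * r ^ (k + 1)) :
    Squarefree (X ^ (k + 2) - C s * X ^ (k + 1) - C c : K[X]) := by
  apply Separable.squarefree
  have hder : derivative (X ^ (k + 2) - C s * X ^ (k + 1) - C c : K[X]) =
      X ^ k * (C ((k + 2 : ℕ) : K) * X - C ((k + 1 : ℕ) * s)) := by
    simp only [derivative_sub, derivative_X_pow, derivative_C_mul, derivative_C, map_mul]
    simp only [Nat.add_sub_cancel, show k + 2 - 1 = k + 1 by omega]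
    ring
  rw [Separable, hder]
  have hroot : ∀ (p : K[X]) (r : K), p.eval r ≠ 0 → IsCoprime p (X - C r) := fun p r h =>
    ((irreducible_X_sub_C r).coprime_iff_not_dvd.mpr (by rwa [dvd_iff_isRoot])).symm
  refine IsCoprime.mul_right (IsCoprime.pow_right ?_) ?_
  · simpa using hroot _ 0 (by simpa using hc)
  by_cases hm : ((k + 2 : ℕ) : K) = 0
  · rw [hm]
    refine isCoprime_one_right.of_isCoprime_of_dvd_right (isUnit_iff_dvd_one.mp ?_)
    have : ((k + 1 : ℕ) : K) = -1 := by
      rw [eq_neg_iff_add_eq_zero, ← hm]; push_cast; ring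
    simpa only [map_zero, zero_mul, zero_sub, this, neg_one_mul, map_neg, neg_neg] using
      (IsUnit.mk0 _ (h0 hm)).map C
  · have : C ((k + 2 : ℕ) : K) * X - C ((k + 1 : ℕ) * s) =
        C ((k + 2 : ℕ) : K) * (X - C ((k + 1 : ℕ) * s / (k + 2 : ℕ))) := by
      rw [mul_sub, ← C_mul, mul_div_cancel₀ _ hm]
    rw [this]
    refine (isCoprime_mul_unit_left_right ((IsUnit.mk0 _ hm).map C) _ _).mpr (hroot _ _ ?_)
    have := h1 ((k + 1 : ℕ) * s / (k + 2 : ℕ)) (mul_div_cancel₀ _ hm)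
    simp only [eval_sub, eval_mul, eval_pow, eval_X, eval_C]
    exact sub_ne_zero.mpr this.symm

open Polynomial in
/-- Replacing the image of the last vector of a cyclic basis turns multiplication by the generator
into an endomorphism annihilated by any prescribed monic polynomial of the right degree. -/
theorem PowerBasis.exists_end_aeval_eq_zero {K S : Type*} [Field K] [CommRing S] [Algebra K S]
    (pb : PowerBasis K S) {m : ℕ} (hdim : pb.dim = m + 1) {P : K[X]} (hP : P.Monic)
    (hdeg : P.natDegree = m + 1) :
    ∃ (h : Module.End K S), aeval h P = 0 ∧
      let d := Algebra.lmul K S pb.gen - h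
      d * d = (pb.basis.repr (pb.gen ^ (m + 1)) ⟨m, by omega⟩ + P.coeff m) • d := by
  let pb' := AdjoinRoot.powerBasis' hP
  have hdim' : pb'.dim = m + 1 := by simp [pb', hdeg]
  let φ : S ≃ₗ[K] AdjoinRoot P :=
    pb.basis.equiv pb'.basis (finCongr (by rw [hdim, hdim']))
  have hφ : ∀ i < m + 1, φ (pb.gen ^ i) = AdjoinRoot.root P ^ i := by
    intro i hi
    have := pb.basis.equiv_apply ⟨i, by omega⟩ pb'.basis (finCongr (by rw [hdim, hdim']))
    simpa [pb'] using this
  let h : Module.End K S := φ.symm.conj (Algebra.lmul K _ (AdjoinRoot.root P))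
  have hh : ∀ i < m + 1, h (pb.gen ^ i) = φ.symm (AdjoinRoot.root P ^ (i + 1)) := by
    intro i hi
    simp [h, LinearEquiv.conj_apply, hφ i hi, pow_succ']
  refine ⟨h, ?_, ?_⟩
  · change aeval (φ.symm.conjAlgEquiv K (Algebra.lmul K _ (AdjoinRoot.root P))) P = 0
    rw [aeval_algHom_apply (φ.symm.conjAlgEquiv K), aeval_algHom_apply]
    simp [AdjoinRoot.aeval_eq]
  · intro d
    let l : Fin pb.dim := ⟨m, by omega⟩
    -- `d` kills every basis vector but the last, so `d x` is the last coordinate of `x` times `w`,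
    -- and `d² = μd` with `μ` the last coordinate of `w`.
    let w : S := pb.gen ^ (m + 1) - φ.symm (AdjoinRoot.root P ^ (m + 1))
    have hd : ∀ x, d x = pb.basis.repr x l • w := by
      have : d = (pb.basis.coord l).smulRight w := by
        refine pb.basis.ext fun i => ?_
        have hi : (i : ℕ) < m + 1 := hdim ▸ i.2
        simp only [LinearMap.smulRight_apply, Module.Basis.coord_apply, Module.Basis.repr_self]
        rw [pb.basis_eq_pow, LinearMap.sub_apply, hh _ hi, Algebra.coe_lmul_eq_mul,
          LinearMap.mul_apply', ← pow_succ']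
        rcases Nat.lt_succ_iff_lt_or_eq.mp hi with h | h
        · rw [← hφ _ (by omega), LinearEquiv.symm_apply_apply, sub_self,
            Finsupp.single_eq_of_ne (by simp [l, Fin.ext_iff]; omega), zero_smul]
        · have : i = l := Fin.ext h
          simp [this, w, l]
      intro x
      rw [this]
      rfl
    have hw : pb.basis.repr w l = pb.basis.repr (pb.gen ^ (m + 1)) l + P.coeff m := by
      have hroot : AdjoinRoot.root P ^ (m + 1) =
          -∑ i ∈ Finset.range (m + 1), P.coeff i • AdjoinRoot.root P ^ i := by
        have h0 : aeval (AdjoinRoot.root P) P = 0 := by simp [AdjoinRoot.aeval_eq]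
        rw [aeval_eq_sum_range, hdeg, Finset.sum_range_succ, ← hdeg, hP.coeff_natDegree, one_smul,
          add_comm] at h0
        rw [← hdeg]
        exact eq_neg_of_add_eq_zero_left h0
      have hsymm : φ.symm (AdjoinRoot.root P ^ (m + 1)) =
          -∑ i ∈ Finset.range (m + 1), P.coeff i • pb.gen ^ i := by
        rw [LinearEquiv.symm_apply_eq, hroot, map_neg, map_sum]
        congr 1
        refine Finset.sum_congr rfl fun i hi => ?_
        rw [map_smul, hφ i (Finset.mem_range.mp hi)]
      have hpow : ∀ i < m + 1, pb.basis.repr (pb.gen ^ i) l = if i = m then 1 else 0 := by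
        intro i hi
        have := pb.basis.repr_self ⟨i, by omega⟩
        rw [pb.basis_eq_pow] at this
        rw [this, Finsupp.single_apply]
        simp [l, Fin.ext_iff]
      simp only [w, hsymm, sub_neg_eq_add, map_add, map_sum, map_smul, Finsupp.add_apply,
        Finsupp.finsetSum_apply, Finsupp.smul_apply, smul_eq_mul]
      congr 1
      rw [Finset.sum_congr rfl fun i hi => by rw [hpow i (Finset.mem_range.mp hi)]]
      simp
    ext x
    simp only [Module.End.mul_apply, LinearMap.smul_apply, hd, map_smul, Finsupp.smul_apply, hw,
      smul_smul, smul_eq_mul]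
    congr 1
    ring

open Polynomial in
theorem Polynomial.exists_squarefree_shift {K : Type*} [Field K] [Fintype K]
    (hq : 3 ≤ Fintype.card K) (k : ℕ) (t : K) :
    ∃ (Q : K[X]) (l : K), Squarefree Q ∧ Q.eval 0 ≠ 0 ∧ l ≠ 0 ∧ (Q.comp (X - C l)).Monic ∧
      (Q.comp (X - C l)).natDegree = k + 2 ∧ t + (Q.comp (X - C l)).coeff (k + 1) ≠ 0 ∧
      l + (t + (Q.comp (X - C l)).coeff (k + 1)) ≠ 0 := by
  obtain ⟨l, s, c, hc, hl, h1, h2, hsf⟩ : ∃ l s c : K, c ≠ 0 ∧ l ≠ 0 ∧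
      t + -(((k + 2 : ℕ) : K) * l + s) ≠ 0 ∧ l + (t + -(((k + 2 : ℕ) : K) * l + s)) ≠ 0 ∧
      Squarefree (X ^ (k + 2) - C s * X ^ (k + 1) - C c : K[X]) := by
    by_cases hm : ((k + 2 : ℕ) : K) = 0
    -- Here the next-to-leading coefficient of the shift is `-s`, independent of `l`. For `t ≠ 0`,
    -- taking `l = -t` turns the last condition into `s ≠ 0`.
    · obtain ⟨l, s, hl, hs, h1, h2⟩ : ∃ l s : K, l ≠ 0 ∧ s ≠ 0 ∧ t - s ≠ 0 ∧ l + (t - s) ≠ 0 := by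
        by_cases ht : t = 0
        · obtain ⟨s, hs, hs'⟩ := exists_ne_ne_of_three_le_card hq (0 : K) 1
          refine ⟨1, s, one_ne_zero, hs, by simpa [ht] using hs, ?_⟩
          simpa [ht, ← sub_eq_add_neg, sub_eq_zero] using hs'.symm
        · obtain ⟨s, hs, hs'⟩ := exists_ne_ne_of_three_le_card hq 0 t
          exact ⟨-t, s, neg_ne_zero.mpr ht, hs, sub_ne_zero.mpr hs'.symm,
            fun h => hs (by linear_combination -h)⟩
      refine ⟨l, s, 1, one_ne_zero, hl, ?_, ?_, ?_⟩
      · simpa [hm, ← sub_eq_add_neg] using h1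
      · rw [hm, zero_mul, zero_add, ← sub_eq_add_neg]
        exact h2
      · refine squarefree_X_pow_sub_sub k one_ne_zero (fun _ => hs) fun r hr => ?_
        have : ((k + 1 : ℕ) : K) = -1 := by
          rw [eq_neg_iff_add_eq_zero, ← hm]; push_cast; ring
        rw [hm, this] at hr
        simp [hs] at hr
    -- With `l = 1`, `s` avoids two values; then `c` avoids 0 and the value that would make the
    -- critical point `r` a root.
    · obtain ⟨s, hs, hs'⟩ := exists_ne_ne_of_three_le_card hq
        (t - ((k + 2 : ℕ) : K)) (1 + t - ((k + 2 : ℕ) : K))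
      let r : K := (k + 1 : ℕ) * s / (k + 2 : ℕ)
      obtain ⟨c, hc, hc'⟩ := exists_ne_ne_of_three_le_card hq 0 (r ^ (k + 2) - s * r ^ (k + 1))
      refine ⟨1, s, c, hc, one_ne_zero, fun h => hs ?_, fun h => hs' ?_, ?_⟩
      · linear_combination -h
      · linear_combination -h
      · refine squarefree_X_pow_sub_sub k hc (fun h => absurd h hm) fun r' hr' => ?_
        have : r' = r := by rw [eq_div_iff hm, mul_comm, hr']
        rwa [this]
  have hmonic : (X ^ (k + 2) - C s * X ^ (k + 1) - C c : K[X]).Monic := by monicity!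
  have hdeg : (X ^ (k + 2) - C s * X ^ (k + 1) - C c : K[X]).natDegree = k + 2 := by
    compute_degree!
  have hcoeff : ((X ^ (k + 2) - C s * X ^ (k + 1) - C c : K[X]).comp (X - C l)).coeff (k + 1) =
      -(((k + 2 : ℕ) : K) * l + s) := by
    rw [sub_comp, sub_comp, mul_comp, C_comp, C_comp, X_pow_comp, X_pow_comp, coeff_sub, coeff_sub,
      coeff_C_mul, coeff_C_succ, sub_eq_add_neg X, ← C_neg, coeff_X_add_C_pow, coeff_X_add_C_pow,
      show k + 2 - (k + 1) = 1 by omega, Nat.choose_succ_self_right]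
    simp
    ring
  refine ⟨_, l, hsf, by simpa using hc, hl, hmonic.comp_X_sub_C l, ?_, ?_, ?_⟩
  · rw [natDegree_comp, hdeg, natDegree_X_sub_C, mul_one]
  · rwa [hcoeff]
  · rwa [hcoeff]

open Polynomial in
theorem PowerBasis.isSumOfInvertibleSemisimple {K S : Type*} [Field K] [Fintype K]
    (hq : 3 ≤ Fintype.card K) [CommRing S] [Algebra K S] (pb : PowerBasis K S) :
    Module.End.IsSumOfInvertibleSemisimple (Algebra.lmul K S pb.gen) := by
  have := pb.finite
  rcases hdim : pb.dim with _ | _ | k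
  · have : Subsingleton S := by
      rw [← Module.finrank_zero_iff (R := K), pb.finrank, hdim]
    exact ⟨0, 0, ⟨isUnit_of_subsingleton _, Module.End.isSemisimple_zero⟩,
      ⟨isUnit_of_subsingleton _, Module.End.isSemisimple_zero⟩, Subsingleton.elim _ _⟩
  · obtain ⟨a, ha⟩ : ∃ a : K, Algebra.lmul K S pb.gen = algebraMap K _ a := by
      have h1 : Module.finrank K S = 1 := by rw [pb.finrank, hdim]
      have : Nontrivial S := Module.nontrivial_of_finrank_pos (R := K) (by omega)
      obtain ⟨a, ha⟩ := (finrank_eq_one_iff_of_nonzero' (1 : S) one_ne_zero).mp h1 pb.gen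
      exact ⟨a, by rw [← ha, ← Algebra.algebraMap_eq_smul_one, AlgHom.commutes]⟩
    obtain ⟨b, hb, hb'⟩ := exists_ne_ne_of_three_le_card hq 0 a
    have hs : ∀ c : K, c ≠ 0 → IsUnit (algebraMap K (Module.End K S) c) ∧
        (algebraMap K (Module.End K S) c).IsSemisimple := fun c hc =>
      ⟨(IsUnit.mk0 c hc).map _, Module.End.isSemisimple_of_squarefree_aeval_eq_zero
        (irreducible_X_sub_C c).squarefree (by simp)⟩
    refine ⟨_, _, hs b hb, hs (a - b) (sub_ne_zero.mpr hb'.symm), ?_⟩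
    rw [← map_add, add_sub_cancel, ha]
  · obtain ⟨Q, l, hQ, hQ0, hl, hmonic, hdeg, hμ, hlμ⟩ := exists_squarefree_shift hq k
      (pb.basis.repr (pb.gen ^ (k + 2)) ⟨k + 1, by omega⟩)
    obtain ⟨h, hP, hd⟩ := pb.exists_end_aeval_eq_zero hdim hmonic hdeg
    set μ := pb.basis.repr (pb.gen ^ (k + 2)) ⟨k + 1, by omega⟩ + (Q.comp (X - C l)).coeff (k + 1)
    simp only at hd
    set d := Algebra.lmul K S pb.gen - h with hd_def
    have hh : aeval (h - algebraMap K _ l) Q = 0 := by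
      simpa [aeval_comp] using hP
    have hg : aeval (algebraMap K _ l + d) ((X - C l) * (X - C (l + μ))) = 0 := by
      simp only [map_mul, map_sub, aeval_X, aeval_C, map_add, add_sub_cancel_left,
        add_sub_add_left_eq_sub]
      rw [mul_sub, hd, ← Algebra.commutes, Algebra.smul_def, sub_self]
    refine ⟨algebraMap K _ l + d, h - algebraMap K _ l, ⟨?_, ?_⟩, ⟨?_, ?_⟩, ?_⟩
    · refine Module.End.isUnit_of_aeval_eq_zero hg ?_
      simpa [hl] using fun H => hlμ (by linear_combination -H)
    · refine Module.End.isSemisimple_of_squarefree_aeval_eq_zero ?_ hg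
      refine (squarefree_mul_iff).mpr ⟨IsCoprime.isRelPrime ?_,
        (irreducible_X_sub_C _).squarefree, (irreducible_X_sub_C _).squarefree⟩
      exact isCoprime_X_sub_C_of_isUnit_sub (by simpa using hμ)
    · exact Module.End.isUnit_of_aeval_eq_zero hh hQ0
    · exact Module.End.isSemisimple_of_squarefree_aeval_eq_zero hQ hh
    · rw [hd_def]; abel

/-! ### Semisimple sums: the general case -/

open Polynomial in
theorem Module.End.isSumOfInvertibleSemisimple {K : Type*} {V : Type*} [Field K] [Fintype K]
    (hq : 3 ≤ Fintype.card K) [AddCommGroup V] [Module K V] [FiniteDimensional K V]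
    (f : Module.End K V) : f.IsSumOfInvertibleSemisimple := by
  classical
  obtain ⟨ι, _, p, hp, e, ⟨φ⟩⟩ := Module.equiv_directSum_of_isTorsion
    (Module.AEval.isTorsion_of_finiteDimensional (K := K) (M := V) (a := f))
  let W : ι → Type _ := fun i => AdjoinRoot (p i ^ e i)
  have hne : ∀ i, p i ^ e i ≠ 0 := fun i => pow_ne_zero _ (hp i).ne_zero
  have : ∀ i, FiniteDimensional K (W i) := fun i => (AdjoinRoot.powerBasis (hne i)).finite
  have hW : ∀ i, IsSumOfInvertibleSemisimple (Algebra.lmul K (W i) (AdjoinRoot.root (p i ^ e i))) :=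
    fun i => (AdjoinRoot.powerBasis (hne i)).isSumOfInvertibleSemisimple hq
  let ψ : Module.AEval' f ≃ₗ[K[X]] ∀ i, K[X] ⧸ Ideal.span {p i ^ e i} :=
    φ ≪≫ₗ DirectSum.linearEquivFunOnFintype K[X] ι _
  -- The `K[X]`-linear decomposition, restricted to scalars in `K`; it carries `f` to multiplication
  -- by the root on each factor.
  let χ : V ≃ₗ[K] ∀ i, W i := Module.AEval'.of f ≪≫ₗ
    { ψ.toAddEquiv with
      map_smul' := fun a x => by
        have := ψ.map_smul (C a) x
        rw [Module.AEval.C_smul] at this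
        refine this.trans (funext fun i => ?_)
        obtain ⟨y, hy⟩ := Submodule.Quotient.mk_surjective _ (ψ x i)
        change C a • ψ x i = a • (show W i from ψ x i)
        rw [← hy]
        change AdjoinRoot.mk _ (C a * y) = a • AdjoinRoot.mk _ y
        rw [AdjoinRoot.smul_mk, smul_eq_C_mul] }
  refine (IsSumOfInvertibleSemisimple.piAlgHom hW).conj χ.symm fun w => ?_
  obtain ⟨v, rfl⟩ := χ.surjective w
  rw [LinearEquiv.symm_apply_apply, LinearEquiv.eq_symm_apply]
  have h1 : ψ (Module.AEval'.of f (f v)) = (X : K[X]) • ψ (Module.AEval'.of f v) := by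
    rw [← map_smul, Module.AEval'.X_smul_of]
  refine h1.trans (funext fun i => ?_)
  change (X : K[X]) • ψ (Module.AEval'.of f v) i =
    AdjoinRoot.root (p i ^ e i) * (show W i from ψ (Module.AEval'.of f v) i)
  obtain ⟨y, hy⟩ := Submodule.Quotient.mk_surjective _ (ψ (Module.AEval'.of f v) i)
  rw [← hy]
  change AdjoinRoot.mk _ (X * y) = AdjoinRoot.mk _ X * AdjoinRoot.mk _ y
  rw [map_mul]

/-- Over a perfect field irreducible factors are automatically separable, so a squarefree minimal
polynomial is enough. -/
theorem Matrix.isSemisimpleMatrix_of_isSemisimple_toLin' {K : Type*} [Field K] [PerfectField K]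
    {m : ℕ} {A : Matrix (Fin m) (Fin m) K} (hA : Module.End.IsSemisimple (toLin' A)) :
    A.IsSemisimpleMatrix := by
  classical
  have hsf : Squarefree (minpoly K A) := by
    rw [← Matrix.minpoly_toLin']
    exact hA.minpoly_squarefree
  have hmonic : (minpoly K A).Monic := minpoly.monic (Algebra.IsIntegral.isIntegral A)
  refine ⟨(UniqueFactorizationMonoid.normalizedFactors (minpoly K A)).toFinset, fun f hf => ?_, ?_⟩
  · have hf' := Multiset.mem_toFinset.mp hf
    have hirr := UniqueFactorizationMonoid.irreducible_of_normalized_factor f hf'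
    refine ⟨?_, hirr, PerfectField.separable_of_irreducible hirr⟩
    rw [← UniqueFactorizationMonoid.normalize_normalized_factor f hf']
    exact Polynomial.monic_normalize hirr.ne_zero
  · have hnodup := (UniqueFactorizationMonoid.squarefree_iff_nodup_normalizedFactors
      hmonic.ne_zero).mp hsf
    rw [Finset.prod.eq_1, Multiset.toFinset_val, hnodup.dedup, Multiset.map_id',
      UniqueFactorizationMonoid.prod_normalizedFactors_eq hmonic.ne_zero, hmonic.normalize_eq_self]

/-! ### Cyclic sums: Hessenberg form -/

/-- A matrix whose entries below the first subdiagonal vanish. -/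
def Matrix.IsUpperHessenberg {R : Type*} [Zero R] {m : ℕ} (H : Matrix (Fin m) (Fin m) R) : Prop :=
  ∀ i j : Fin m, (j : ℕ) + 1 < i → H i j = 0

open Set Submodule in
theorem Module.End.exists_linearIndepOn_hessenberg {K V : Type*} [Field K] [AddCommGroup V]
    [Module K V] [FiniteDimensional K V] (f : Module.End K V) (m : ℕ)
    (hm : m ≤ Module.finrank K V) :
    ∃ v : ℕ → V, LinearIndepOn K v (Iio m) ∧
      ∀ k, k + 1 < m → f (v k) ∈ span K (v '' Iio (k + 2)) := by
  classical
  induction m with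
  | zero => exact ⟨0, by simp, by simp⟩
  | succ m ih =>
    obtain ⟨v, hv, hf⟩ := ih (by omega)
    -- The next vector is the image of the previous one if that is new, and any vector outside the
    -- span otherwise. For `m = 0` the index `m - 1` is harmless: no image condition is then
    -- required.
    obtain ⟨w, hw, hfw⟩ : ∃ w, w ∉ span K (v '' Iio m) ∧
        f (v (m - 1)) ∈ span K (insert w (v '' Iio m)) := by
      by_cases h : f (v (m - 1)) ∈ span K (v '' Iio m)
      · obtain ⟨w, hw⟩ : ∃ w, w ∉ span K (v '' Iio m) := by
          by_contra! hall
          have htop : span K (v '' Iio m) = ⊤ := eq_top_iff.mpr fun x _ => hall x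
          have hle := finrank_span_finset_le_card (R := K) ((Finset.range m).image v)
          rw [Finset.coe_image, Finset.coe_range, Set.finrank, htop, finrank_top] at hle
          have := hle.trans Finset.card_image_le
          rw [Finset.card_range] at this
          omega
        exact ⟨w, hw, span_mono (subset_insert _ _) h⟩
      · exact ⟨_, h, subset_span (mem_insert _ _)⟩
    have heq : EqOn (Function.update v m w) v (Iio m) := fun i hi =>
      Function.update_of_ne (ne_of_lt hi) _ _
    have himg : ∀ k ≤ m, Function.update v m w '' Iio k = v '' Iio k := fun k hk =>
      image_congr fun i hi => heq (lt_of_lt_of_le hi hk)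
    have hins : Iio (m + 1) = insert m (Iio m) := by
      ext i
      simp only [mem_Iio, mem_insert_iff]
      omega
    refine ⟨Function.update v m w, ?_, fun k hk => ?_⟩
    · rw [hins]
      refine LinearIndepOn.insert ((linearIndepOn_congr heq).mpr hv) ?_
      rwa [himg m le_rfl, Function.update_self]
    · rw [heq (show k < m by omega)]
      rcases Nat.lt_or_ge (k + 1) m with h | h
      · rw [himg (k + 2) (by omega)]
        exact hf k h
      · obtain rfl : m = k + 1 := by omega
        rwa [hins, image_insert_eq, himg _ le_rfl, Function.update_self]

open Set Submodule in
theorem Matrix.exists_isUpperHessenberg_conj {K : Type*} [Field K] {m : ℕ}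
    (A : Matrix (Fin m) (Fin m) K) :
    ∃ (e : (Fin m → K) ≃ₗ[K] (Fin m → K)) (H : Matrix (Fin m) (Fin m) K),
      H.IsUpperHessenberg ∧ toLin' A = e.conj (toLin' H) := by
  obtain ⟨v, hv, hf⟩ := Module.End.exists_linearIndepOn_hessenberg (toLin' A) m (by simp)
  have hli : LinearIndependent K fun i : Fin m => v i :=
    hv.comp (fun i : Fin m => (⟨i, i.2⟩ : Iio m)) fun i j h => Fin.ext (congrArg Subtype.val h)
  let b := basisOfLinearIndependentOfCardEqFinrank' (fun i : Fin m => v i) hli (by simp)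
  have hb : ∀ i, b i = v i := fun i => by simp [b]
  refine ⟨b.equivFun.symm, LinearMap.toMatrix' (b.equivFun.conj (toLin' A)), fun i j hij => ?_, ?_⟩
  · have hspan : toLin' A (b j) ∈ span K (b '' {k | (k : ℕ) < j + 2}) := by
      rw [hb]
      refine span_mono ?_ (hf j (by omega))
      rintro _ ⟨k, hk, rfl⟩
      have hk' : k < j + 2 := hk
      exact ⟨⟨k, by omega⟩, hk', by rw [hb]⟩
    have hsupp := b.repr_support_subset_of_mem_span _ hspan
    have : b.repr (toLin' A (b j)) i = 0 := by
      by_contra hne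
      have : (i : ℕ) < j + 2 := hsupp (Finsupp.mem_support_iff.mpr hne)
      omega
    rw [LinearMap.toMatrix'_apply]
    simpa [LinearEquiv.conj_apply, ← Pi.single_apply] using this
  · refine LinearMap.ext fun x => ?_
    simp [LinearEquiv.conj_apply]

theorem Matrix.isCyclicMatrix_conj {K : Type*} [Field K] {m : ℕ} {A : Matrix (Fin m) (Fin m) K}
    (hA : A.IsCyclicMatrix) (e : (Fin m → K) ≃ₗ[K] (Fin m → K)) :
    (LinearMap.toMatrix' (e.conj (toLin' A))).IsCyclicMatrix := by
  obtain ⟨v, hv⟩ := hA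
  refine ⟨e v, ?_⟩
  have h : (fun i : Fin m => (LinearMap.toMatrix' (e.conj (toLin' A)) ^ (i : ℕ)).mulVec (e v)) =
      e ∘ fun i : Fin m => (A ^ (i : ℕ)).mulVec v := by
    ext1 i
    rw [← toLin'_apply, toLin'_pow, toLin'_toMatrix', Function.comp_apply, ← toLin'_apply (A ^ _),
      toLin'_pow]
    change ((e.conjAlgEquiv K (toLin' A)) ^ (i : ℕ)) (e v) = _
    rw [← map_pow]
    rw [LinearEquiv.conjAlgEquiv_apply]
    simp
  rw [h, Set.range_comp, ← LinearEquiv.coe_coe, Submodule.span_image, hv, Submodule.map_top,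
    LinearEquiv.range]

/-- The first basis vector is cyclic: `H e_k` is a nonzero multiple of `e_{k+1}` plus earlier basis
vectors, so each `e_k` lies in the span of `e_0, …, H^k e_0`. -/
theorem Matrix.IsUpperHessenberg.isCyclicMatrix {K : Type*} [Field K] {m : ℕ}
    {H : Matrix (Fin (m + 1)) (Fin (m + 1)) K} (hH : H.IsUpperHessenberg)
    (hsub : ∀ i : Fin m, H i.succ i.castSucc ≠ 0) : H.IsCyclicMatrix := by
  refine ⟨Pi.single 0 1, ?_⟩
  let u : ℕ → Fin (m + 1) → K := fun i => (H ^ i).mulVec (Pi.single 0 1)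
  have key : ∀ k : ℕ, ∀ hk : k < m + 1,
      (Pi.single ⟨k, hk⟩ 1 : Fin (m + 1) → K) ∈ Submodule.span K (u '' Set.Iic k) := by
    intro k
    induction k using Nat.strong_induction_on with
    | _ k ih =>
      intro hk
      rcases k with _ | k
      · exact Submodule.subset_span ⟨0, by simp, by simp only [u, pow_zero, one_mulVec]; rfl⟩
      · have hprev := ih k (by omega) (by omega)
        have hmap : H.mulVec (Pi.single ⟨k, by omega⟩ 1) ∈
            Submodule.span K (u '' Set.Iic (k + 1)) := by
          have h1 : toLin' H (Pi.single ⟨k, by omega⟩ 1) ∈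
              (Submodule.span K (u '' Set.Iic k)).map (toLin' H) :=
            Submodule.mem_map_of_mem hprev
          rw [Submodule.map_span] at h1
          refine Submodule.span_mono ?_ h1
          rintro _ ⟨_, ⟨i, hi, rfl⟩, rfl⟩
          have hi' : i ≤ k := hi
          exact ⟨i + 1, Nat.succ_le_succ hi', by rw [toLin'_apply, mulVec_mulVec, ← pow_succ']⟩
        have hcol : H.mulVec (Pi.single ⟨k, by omega⟩ 1) =
            ∑ i : Fin (m + 1), H i ⟨k, by omega⟩ • Pi.single i (1 : K) := by
          ext j
          simp [Pi.single_apply]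
        rw [hcol, ← Finset.add_sum_erase _ _ (Finset.mem_univ (⟨k + 1, hk⟩ : Fin (m + 1)))] at hmap
        have hrest : ∑ i ∈ Finset.univ.erase (⟨k + 1, hk⟩ : Fin (m + 1)),
            H i ⟨k, by omega⟩ • (Pi.single i (1 : K) : Fin (m + 1) → K) ∈
              Submodule.span K (u '' Set.Iic (k + 1)) := by
          refine Submodule.sum_mem _ fun i hi => ?_
          have hne : (i : ℕ) ≠ k + 1 := fun h => Finset.ne_of_mem_erase hi (Fin.ext h)
          rcases Nat.lt_or_ge (k + 1) i with h | h
          · rw [hH i ⟨k, by omega⟩ h, zero_smul]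
            exact Submodule.zero_mem _
          · refine Submodule.smul_mem _ _ (Submodule.span_mono ?_ (ih i (by omega) i.2))
            exact Set.image_mono (Set.Iic_subset_Iic.mpr h)
        have hmain := (Submodule.add_mem_iff_left _ hrest).mp hmap
        exact (Submodule.smul_mem_iff _ (hsub ⟨k, by omega⟩)).mp hmain
  rw [eq_top_iff, ← (Pi.basisFun K (Fin (m + 1))).span_eq, Submodule.span_le]
  rintro _ ⟨i, rfl⟩
  rw [Pi.basisFun_apply]
  refine Submodule.span_mono ?_ (key i i.2)
  rintro _ ⟨j, hj, rfl⟩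
  have hj' : j ≤ i := hj
  exact ⟨⟨j, by omega⟩, rfl⟩

/-- Expand along the first row: the minor at the corner is upper triangular with the subdiagonal of
`H` as its diagonal, so the determinant is affine in `t` with nonzero slope. -/
theorem Matrix.IsUpperHessenberg.exists_isUnit_add_single {K : Type*} [Field K] {m : ℕ}
    {H : Matrix (Fin (m + 1)) (Fin (m + 1)) K} (hH : H.IsUpperHessenberg)
    (hsub : ∀ i : Fin m, H i.succ i.castSucc ≠ 0) :
    ∃ t₀ : K, ∀ t, t ≠ t₀ → IsUnit (H + Matrix.single 0 (Fin.last m) t) := by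
  obtain ⟨c, hc, hdet⟩ : ∃ c : K, c ≠ 0 ∧
      ∀ t, (H + Matrix.single 0 (Fin.last m) t).det = H.det + t * c := by
    refine ⟨(-1) ^ m * ∏ i : Fin m, H i.succ i.castSucc,
      mul_ne_zero (pow_ne_zero _ (neg_ne_zero.mpr one_ne_zero))
        (Finset.prod_ne_zero_iff.mpr fun i _ => hsub i), fun t => ?_⟩
    have hminor : (H.submatrix Fin.succ (Fin.last m).succAbove).det =
        ∏ i : Fin m, H i.succ i.castSucc := by
      rw [det_of_isUpperTriangular]
      · simp
      · intro i j hij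
        have hij' : j < i := hij
        refine hH _ _ ?_
        simpa using hij'
    have hsm : ∀ j : Fin (m + 1), (H + Matrix.single 0 (Fin.last m) t).submatrix
        Fin.succ j.succAbove = H.submatrix Fin.succ j.succAbove := by
      intro j
      ext a b
      simp [(Fin.succ_ne_zero a).symm]
    rw [det_succ_row_zero, det_succ_row_zero H]
    simp only [hsm, add_apply, mul_add, add_mul, Finset.sum_add_distrib]
    congr 1
    rw [Finset.sum_eq_single (Fin.last m)]
    · rw [hminor]
      simp
      ring
    · intro j _ hj
      simp [hj.symm]
    · simp
  refine ⟨-H.det / c, fun t ht => ?_⟩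
  rw [isUnit_iff_isUnit_det, hdet, isUnit_iff_ne_zero]
  contrapose! ht
  rw [eq_div_iff hc]
  linear_combination ht

theorem Matrix.IsUpperHessenberg.exists_add_isUnit_isCyclicMatrix {K : Type*} [Field K] [Fintype K]
    (hq : 3 ≤ Fintype.card K) {m : ℕ} {H : Matrix (Fin (m + 1)) (Fin (m + 1)) K}
    (hH : H.IsUpperHessenberg) :
    ∃ B C : Matrix (Fin (m + 1)) (Fin (m + 1)) K,
      (IsUnit B ∧ B.IsCyclicMatrix) ∧ (IsUnit C ∧ C.IsCyclicMatrix) ∧ H = B + C := by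
  -- `β a` differs from 0 and `a`, so `a = β a + (a - β a)` has both terms nonzero.
  choose β hβ hβ' using exists_ne_ne_of_three_le_card hq (0 : K)
  let B : Matrix (Fin (m + 1)) (Fin (m + 1)) K :=
    Matrix.of fun i j => if (i : ℕ) = j + 1 then β (H i j) else 0
  have hB : B.IsUpperHessenberg := fun i j hij => if_neg (by omega)
  have hC : (H - B).IsUpperHessenberg := fun i j hij => by
    rw [sub_apply, hH i j hij, hB i j hij, sub_zero]
  have hBi : ∀ i : Fin m, B i.succ i.castSucc = β (H i.succ i.castSucc) := fun i => by simp [B]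
  have hadd : ∀ {H' : Matrix (Fin (m + 1)) (Fin (m + 1)) K} (t : K), H'.IsUpperHessenberg →
      (∀ i : Fin m, H' i.succ i.castSucc ≠ 0) →
      (H' + Matrix.single 0 (Fin.last m) t).IsCyclicMatrix := fun {H'} t hH' hsub =>
    isCyclicMatrix (fun i j hij => by
      have : (0 : Fin (m + 1)) ≠ i := fun h => by simp [← h] at hij
      simp [hH' i j hij, this])
      fun i => by simpa [Matrix.single_apply, (Fin.succ_ne_zero i).symm] using hsub i
  have hBsub : ∀ i : Fin m, B i.succ i.castSucc ≠ 0 := fun i => by rw [hBi]; exact hβ _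
  have hCsub : ∀ i : Fin m, (H - B) i.succ i.castSucc ≠ 0 := fun i => by
    rw [sub_apply, hBi]; exact sub_ne_zero.mpr (hβ' _).symm
  obtain ⟨t₁, h₁⟩ := hB.exists_isUnit_add_single hBsub
  obtain ⟨t₂, h₂⟩ := hC.exists_isUnit_add_single hCsub
  -- The second summand receives `-t` in the corner, hence the excluded value `-t₂`.
  obtain ⟨t, ht₁, ht₂⟩ := exists_ne_ne_of_three_le_card hq t₁ (-t₂)
  refine ⟨B + Matrix.single 0 (Fin.last m) t, H - B + Matrix.single 0 (Fin.last m) (-t),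
    ⟨h₁ t ht₁, hadd t hB hBsub⟩,
    ⟨h₂ (-t) fun h => ht₂ (by rw [← h, neg_neg]), hadd (-t) hC hCsub⟩, ?_⟩
  rw [← Matrix.single_neg]
  abel

theorem theorem1p5 {F : Type*} [Field F] [Fintype F] (hq : 3 ≤ Fintype.card F)
    (n : ℕ) (hn : 2 ≤ n) (A : Matrix (Fin n) (Fin n) F) :
    (∃ B C : Matrix (Fin n) (Fin n) F,
      (IsUnit B ∧ B.IsCyclicMatrix) ∧ (IsUnit C ∧ C.IsCyclicMatrix) ∧ A = B + C) ∧
    (∃ B C : Matrix (Fin n) (Fin n) F,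
      (IsUnit B ∧ B.IsSemisimpleMatrix) ∧ (IsUnit C ∧ C.IsSemisimpleMatrix) ∧ A = B + C) := by
  constructor
  · obtain ⟨m, rfl⟩ : ∃ m, n = m + 1 := ⟨n - 1, by omega⟩
    obtain ⟨e, H, hH, hA⟩ := A.exists_isUpperHessenberg_conj
    obtain ⟨B, C, ⟨hB, hBc⟩, ⟨hC, hCc⟩, rfl⟩ := hH.exists_add_isUnit_isCyclicMatrix hq
    have hunit : ∀ {M : Matrix (Fin (m + 1)) (Fin (m + 1)) F}, IsUnit M →
        IsUnit (LinearMap.toMatrix' (e.conj (Matrix.toLin' M))) := fun hM =>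
      ((hM.map Matrix.toLinAlgEquiv').map (e.conjAlgEquiv F)).map LinearMap.toMatrixAlgEquiv'
    refine ⟨_, _, ⟨hunit hB, Matrix.isCyclicMatrix_conj hBc e⟩,
      ⟨hunit hC, Matrix.isCyclicMatrix_conj hCc e⟩, ?_⟩
    rw [← map_add LinearMap.toMatrix', ← map_add e.conj, ← map_add Matrix.toLin', ← hA,
      LinearMap.toMatrix'_toLin']
  · obtain ⟨g, h, ⟨hg, hg'⟩, ⟨hh, hh'⟩, hgh⟩ :=
      Module.End.isSumOfInvertibleSemisimple hq (Matrix.toLin' A)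
    refine ⟨LinearMap.toMatrix' g, LinearMap.toMatrix' h,
      ⟨hg.map LinearMap.toMatrixAlgEquiv', Matrix.isSemisimpleMatrix_of_isSemisimple_toLin' ?_⟩,
      ⟨hh.map LinearMap.toMatrixAlgEquiv', Matrix.isSemisimpleMatrix_of_isSemisimple_toLin' ?_⟩, ?_⟩
    · rwa [Matrix.toLin'_toMatrix']
    · rwa [Matrix.toLin'_toMatrix']
    · rw [← map_add, ← hgh, LinearMap.toMatrix'_toLin']
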